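/- Let $k\in\mathbb N$ and let $V$ be a vector space over $GF(2)$ with a skew symmetric bilinear form $\beta$ and with a basis consisting of vectors $e_i$ ($i\in\mathbb N$) and $e_i^*$ ($i<k$) such that $\beta(e_i,e_j)=0$, $\beta(e^*_i,e^*_j)=0$, and $\beta(e_i,e^*_j)=1$ if $i=j$ and $0$ otherwise. Thus $V=V_1\oplus \mathrm{Rad}(V)$, where $V_1=\bigoplus_{i<k}\langle e_i,e_i^*\rangle$ is a sum of $k$ hyperbolic planes and $\mathrm{Rad}(V)=\langle e_i : i\ge k\rangle$ is infinite dimensional. For a subspace $X\le V$ write $\mathrm{Rad}(X)=X\cap X^{\perp}$. For subspaces $X,Y\le V$, a copy of $X$ in $Y$ is a subspace of $Y$ which is linearly isometric to $X$, and $\binom{Y}{X}$ denotes the set of all copies of $X$ in $Y$. Let $A\le V$ be a finite subspace with a decomposition $A=A_0\oplus A_1$, where $A_1\le V_1$ and $A_0=\mathrm{Rad}(A)=A\cap \mathrm{Rad}(V)$. Then for every $r\in\mathbb N$ and every finite subspace $B\le \mathrm{Rad}(V)\oplus A_1$ with $A\le B$ there is a finite subspace $C\le \mathrm{Rad}(V)\oplus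 A_1$ such that for every colouring $\xi:\binom{C}{A}\to\{1,\dots,r\}$ there is a copy $B'$ of $B$ with $A_1\le B'\le C$ such that $\xi$ is constant on the set of all $A'\in\binom{B'}{A}$ of the form $A'=A_0'\oplus A_1$ for some subspace $A'_0\le V$. -/

import Mathlib

/-- `e i = b (inl i)` (`i : ℕ`) and `e* i = b (inr i)` (`i < k`) form a basis of `V` that exhibits
the skew symmetric bilinear form `β` over `GF(2)` as the orthogonal sum of the `k` hyperbolic planes
`⟨e i, e* i⟩` (`i < k`) and the infinite dimensional radical spanned by the `e i` with `k ≤ i`. -/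
structure IsHyperbolicRadicalBasis {V : Type*} [AddCommGroup V] [Module (ZMod 2) V] {k : ℕ}
    (β : LinearMap.BilinForm (ZMod 2) V) (b : Module.Basis (ℕ ⊕ Fin k) (ZMod 2) V) : Prop where
  skew : ∀ u v : V, β u v = -β v u
  e_e : ∀ i j : ℕ, β (b (Sum.inl i)) (b (Sum.inl j)) = 0
  estar_estar : ∀ i j : Fin k, β (b (Sum.inr i)) (b (Sum.inr j)) = 0
  e_estar : ∀ (i : ℕ) (j : Fin k),
    β (b (Sum.inl i)) (b (Sum.inr j)) = if i = (j : ℕ) then 1 else 0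

/-- The sum `V₁` of the hyperbolic planes `⟨e i, e* i⟩`, `i < k`. -/
def hyperbolicPart {V : Type*} [AddCommGroup V] [Module (ZMod 2) V] {k : ℕ}
    (b : Module.Basis (ℕ ⊕ Fin k) (ZMod 2) V) : Submodule (ZMod 2) V :=
  Submodule.span (ZMod 2)
    (Set.range (fun i : Fin k => b (Sum.inl (i : ℕ))) ∪ Set.range (fun i : Fin k => b (Sum.inr i)))

/-- The radical `X ∩ X^⊥` of the subspace `X` with the restricted form; the radical of the whole
space is `formRad β ⊤`. -/
def formRad {V : Type*} [AddCommGroup V] [Module (ZMod 2) V]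
    (β : LinearMap.BilinForm (ZMod 2) V) (X : Submodule (ZMod 2) V) : Submodule (ZMod 2) V :=
  X ⊓ β.orthogonal X

/-- Two subspaces are isometric: isomorphic as vector spaces with a bilinear form. -/
def IsometricSubspaces {V : Type*} [AddCommGroup V] [Module (ZMod 2) V]
    (β : LinearMap.BilinForm (ZMod 2) V) (X Y : Submodule (ZMod 2) V) : Prop :=
  ∃ f : X ≃ₗ[ZMod 2] Y, ∀ x y : X, β (f x : V) (f y : V) = β (x : V) (y : V)

/-- The set `(C choose A)` of all copies of `A` in `C`: subspaces of `C` isometric to `A`. -/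
def copiesIn {V : Type*} [AddCommGroup V] [Module (ZMod 2) V]
    (β : LinearMap.BilinForm (ZMod 2) V) (C A : Submodule (ZMod 2) V) :
    Set (Submodule (ZMod 2) V) :=
  {A' | A' ≤ C ∧ IsometricSubspaces β A A'}

/-! The form does not see the radical. A copy `A'` of `A` containing `A₁` inside `Rad(V) ⊕ A₁` is
`(A' ∩ Rad(V)) ⊕ A₁`, with radical part of dimension `dim A₀`; conversely, any subspace of `Rad(V)`
of dimension `dim (B ∩ Rad(V))`, summed with `A₁`, is a copy of `B`. So the claim reduces to the
Ramsey theorem for subspaces of a finite vector space, `exists_subspaceRamsey`.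

That theorem is proved by induction on `t` and on `∑ d i`, which is why each colour has its own
target dimension. Hales–Jewett makes colours of graphs invariant in a direction `w`. Subspaces
containing `w` are handled by the case `t`, the others are graphs handled by a smaller `∑ d i`;
adjoining `w` regains the lost dimension. -/

section

variable {F : Type} [Field F]

/-- Every colouring of the `t`-dimensional subspaces of `X` admits, for some colour `i`, a subspace
of dimension `d i` all of whose `t`-dimensional subspaces have colour `i`. -/
def SubspaceRamsey (F : Type) [Field F] {K : Type} (t : ℕ) (d : K → ℕ) (X : Type*)
    [AddCommGroup X] [Module F X] : Prop :=
  ∀ c : Submodule F X → K, ∃ (i : K) (Y : Submodule F X), Module.finrank F Y = d i ∧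
    ∀ S ≤ Y, Module.finrank F S = t → c S = i

theorem Submodule.exists_map_eq_of_le_map {X V : Type*} [AddCommGroup X] [Module F X]
    [AddCommGroup V] [Module F V] {f : X →ₗ[F] V} (hf : Function.Injective f) {Y : Submodule F X}
    {S : Submodule F V} (hS : S ≤ Y.map f) :
    ∃ T ≤ Y, T.map f = S ∧ Module.finrank F T = Module.finrank F S := by
  have h : (S.comap f).map f = S :=
    Submodule.map_comap_eq_of_le (hS.trans (LinearMap.map_le_range))
  refine ⟨S.comap f, ?_, h, ?_⟩
  · rw [← Submodule.comap_map_eq_of_injective hf Y]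
    exact Submodule.comap_mono hS
  · conv_rhs => rw [← h]
    exact (Submodule.equivMapOfInjective f hf _).finrank_eq

theorem SubspaceRamsey.of_injective {K : Type} {t : ℕ} {d : K → ℕ} {X V : Type*}
    [AddCommGroup X] [Module F X] [AddCommGroup V] [Module F V]
    (h : SubspaceRamsey F t d X) {f : X →ₗ[F] V} (hf : Function.Injective f) :
    SubspaceRamsey F t d V := by
  intro c
  obtain ⟨i, Y, hY, hc⟩ := h fun S => c (S.map f)
  refine ⟨i, Y.map f, (Submodule.equivMapOfInjective f hf Y).finrank_eq.symm.trans hY, fun S hS hSt => ?_⟩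
  obtain ⟨T, hT, rfl, hr⟩ := Submodule.exists_map_eq_of_le_map hf hS
  exact hc T hT (hr.trans hSt)

/-- A consequence of the Hales–Jewett theorem: the colour of the graph over `T` of a linear map does
not change when a map in a suitable direction `w` is added. -/
theorem exists_graph_colour_eq [Finite F] (X K : Type) [AddCommGroup X] [Module F X] [Finite X]
    [Finite K] :
    ∃ (ι : Type) (_ : Fintype ι), ∀ c : Submodule F (X × (ι → F)) → K,
      ∃ (a : X →ₗ[F] ι → F) (w : ι → F), w ≠ 0 ∧ ∀ (T : Submodule F X) (φ : X →ₗ[F] F),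
        c (T.map (LinearMap.id.prod (a + φ.smulRight w))) = c (T.map (LinearMap.id.prod a)) := by
  have : Finite (Submodule F X) := Finite.of_injective _ (SetLike.coe_injective (B := X))
  have : Finite (X →ₗ[F] F) := DFunLike.finite _
  obtain ⟨ι, hι, h⟩ :=
    Combinatorics.Line.exists_mono_in_high_dimension (X →ₗ[F] F) (Submodule F X → K)
  refine ⟨ι, hι, fun c => ?_⟩
  -- A word over the alphabet of functionals is a linear map `X → F^ι`; its colour records the
  -- colours of its graphs over all `T` at once.
  obtain ⟨l, κ, hl⟩ := h fun u T => c (T.map (LinearMap.id.prod (LinearMap.pi u)))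
  have hw : ∀ φ : X →ₗ[F] F, LinearMap.pi (l φ) = LinearMap.pi (l 0) +
      -- The direction `w` is the indicator of the active coordinates of the line.
      φ.smulRight (fun j => if l.idxFun j = none then (1 : F) else 0) := by
    intro φ
    ext x j
    cases hj : l.idxFun j <;> simp [hj, Combinatorics.Line.coe_apply]
  refine ⟨LinearMap.pi (l 0), fun j => if l.idxFun j = none then 1 else 0, ?_, fun T φ => ?_⟩
  · obtain ⟨j, hj⟩ := l.proper
    intro h0
    simpa [hj] using congrFun h0 j
  · rw [← hw]
    exact (congrFun (hl φ) T).trans (congrFun (hl 0) T).symm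

/-- If the colour of a subspace of `X × W` which is a graph over a subspace of `X` depends only on
the latter, then `SubspaceRamsey` lifts from `X` to `X × W`. -/
theorem exists_monochromatic_of_graph {K : Type} {t : ℕ} {d : K → ℕ} [DecidableEq K] {X W : Type*}
    [AddCommGroup X] [Module F X] [FiniteDimensional F X] [AddCommGroup W] [Module F W]
    [FiniteDimensional F W] {c : Submodule F (X × W) → K} {a : X →ₗ[F] W} {w : W} (hw : w ≠ 0)
    (hc : ∀ (T : Submodule F X) (φ : X →ₗ[F] F),
      c (T.map (LinearMap.id.prod (a + φ.smulRight w))) = c (T.map (LinearMap.id.prod a)))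
    {j : K} (hj : 0 < d j) {Z : Submodule F X}
    (hZ : ∀ S ≤ Z, Module.finrank F S = t →
      c (S.map (LinearMap.id.prod a) ⊔ F ∙ ((0, w) : X × W)) = j)
    (h : SubspaceRamsey F (t + 1) (Function.update d j (d j - 1)) Z) :
    ∃ (i : K) (Y : Submodule F (X × W)), Module.finrank F Y = d i ∧
      ∀ S ≤ Y, Module.finrank F S = t + 1 → c S = i := by
  set g : X →ₗ[F] X × W := LinearMap.id.prod a with hg
  have hginj : Function.Injective g := fun x y hxy => congrArg Prod.fst hxy
  have hrank : ∀ T : Submodule F X,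
      Module.finrank F ↥(T.map g ⊔ F ∙ ((0, w) : X × W)) = Module.finrank F T + 1 := by
    intro T
    have hd : Disjoint (T.map g) (F ∙ ((0, w) : X × W)) := by
      rw [Submodule.disjoint_span_singleton' (by simpa using hw)]
      rintro ⟨x, -, hx⟩
      obtain rfl : x = 0 := congrArg Prod.fst hx
      rw [map_zero] at hx
      exact hw (congrArg Prod.snd hx).symm
    have := Submodule.finrank_sup_add_finrank_inf_eq (T.map g) (F ∙ ((0, w) : X × W))
    rw [hd.eq_bot, finrank_bot, finrank_span_singleton (by simpa using hw),
      ← (Submodule.equivMapOfInjective g hginj T).finrank_eq] at this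
    simpa using this
  obtain ⟨i, Y₀, hY₀, hcY₀⟩ := h fun S => c ((S.map Z.subtype).map g)
  set Y := Y₀.map Z.subtype with hYdef
  have hYZ : Y ≤ Z := Submodule.map_subtype_le _ _
  have hY : Module.finrank F Y = Function.update d j (d j - 1) i := by
    rw [← hY₀]
    exact (Submodule.equivMapOfInjective _ Z.injective_subtype Y₀).finrank_eq.symm
  have hcY : ∀ T ≤ Y, Module.finrank F T = t + 1 → c (T.map g) = i := by
    intro T hT hTt
    obtain ⟨T', hT', rfl, hr⟩ := Submodule.exists_map_eq_of_le_map Z.injective_subtype hT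
    exact hcY₀ T' hT' (hr.trans hTt)
  clear_value Y
  by_cases hij : i = j
  · subst hij
    rw [Function.update_self] at hY
    refine ⟨i, Y.map g ⊔ F ∙ ((0, w) : X × W), by rw [hrank]; omega, fun S hS hSt => ?_⟩
    have hmem : ∀ s ∈ S, s.1 ∈ Y ∧ ∃ α : F, s = g s.1 + α • ((0, w) : X × W) := by
      intro s hs
      obtain ⟨_, ⟨y, hy, rfl⟩, z, hz, rfl⟩ := Submodule.mem_sup.mp (hS hs)
      obtain ⟨α, rfl⟩ := Submodule.mem_span_singleton.mp hz
      have : (g y + α • ((0, w) : X × W)).1 = y := by simp [hg]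
      rw [this]
      exact ⟨hy, α, rfl⟩
    have hTY : S.map (LinearMap.fst F X W) ≤ Y := by
      rintro _ ⟨s, hs, rfl⟩
      exact (hmem s hs).1
    -- If `w ∈ S`, the projection of `S` has dimension `t`; otherwise `S` is a graph over a
    -- projection of dimension `t + 1`.
    by_cases hwS : ((0, w) : X × W) ∈ S
    · have hST : S = (S.map (LinearMap.fst F X W)).map g ⊔ F ∙ ((0, w) : X × W) := by
        apply le_antisymm
        · intro s hs
          obtain ⟨-, α, hα⟩ := hmem s hs
          rw [hα]
          exact Submodule.add_mem_sup ⟨_, ⟨s, hs, rfl⟩, rfl⟩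
            (Submodule.smul_mem _ _ (Submodule.mem_span_singleton_self _))
        · refine sup_le ?_ (by simpa using hwS)
          rintro _ ⟨_, ⟨s, hs, rfl⟩, rfl⟩
          obtain ⟨-, α, hα⟩ := hmem s hs
          rw [LinearMap.fst_apply, ← sub_eq_of_eq_add hα]
          exact S.sub_mem hs (S.smul_mem _ hwS)
      rw [hST]
      refine hZ _ (hTY.trans hYZ) ?_
      rw [hST, hrank] at hSt
      omega
    · have hinj : Function.Injective ((LinearMap.fst F X W).domRestrict S) := by
        rw [← LinearMap.ker_eq_bot, LinearMap.ker_eq_bot']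
        rintro ⟨s, hs⟩ hs0
        obtain ⟨-, α, hα⟩ := hmem s hs
        replace hs0 : s.1 = 0 := hs0
        rw [hs0, map_zero, zero_add] at hα
        by_cases hα0 : α = 0
        · simpa [hα0] using hα
        · exact absurd (by rwa [hα, S.smul_mem_iff hα0] at hs) hwS
      -- As `ψ w = 1`, `ψ` reads off the coefficient of `w`, which gives the functional `φ` whose
      -- graph is `S`.
      obtain ⟨ψ, hψ⟩ := LinearMap.exists_leftInverse_of_injective (LinearMap.toSpanSingleton F W w)
        (LinearMap.ker_toSpanSingleton F hw)
      replace hψ : ψ w = 1 := by simpa using LinearMap.congr_fun hψ 1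
      let e := LinearEquiv.ofInjective _ hinj
      obtain ⟨φ, hφ⟩ := LinearMap.exists_extend
        ((ψ ∘ₗ (LinearMap.snd F X W - a ∘ₗ LinearMap.fst F X W) ∘ₗ S.subtype) ∘ₗ e.symm.toLinearMap)
      have hS' : ∀ s ∈ S, s = LinearMap.id.prod (a + φ.smulRight w) s.1 := by
        intro s hs
        obtain ⟨-, α, hα⟩ := hmem s hs
        have h1 : φ s.1 = ψ (s.2 - a s.1) := by
          have := LinearMap.congr_fun hφ (e ⟨s, hs⟩)
          simpa [e] using this
        have h2 : s.2 = a s.1 + α • w := congrArg Prod.snd hα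
        have h3 : φ s.1 = α := by simp [h1, h2, hψ]
        ext1
        · rfl
        · simp [h3, h2]
      have hST : (S.map (LinearMap.fst F X W)).map (LinearMap.id.prod (a + φ.smulRight w)) = S := by
        rw [← Submodule.map_comp]
        apply le_antisymm
        · rintro _ ⟨s, hs, rfl⟩
          rw [LinearMap.comp_apply, LinearMap.fst_apply, ← hS' s hs]
          exact hs
        · exact fun s hs => ⟨s, hs, (hS' s hs).symm⟩
      rw [← hST, hc]
      refine hcY _ hTY ?_
      rw [← hSt, e.finrank_eq, LinearMap.range_domRestrict]
  · rw [Function.update_of_ne hij] at hY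
    refine ⟨i, Y.map g, (Submodule.equivMapOfInjective g hginj Y).finrank_eq.symm.trans hY,
      fun S hS hSt => ?_⟩
    obtain ⟨T, hT, rfl, hr⟩ := Submodule.exists_map_eq_of_le_map hginj hS
    exact hcY T hT (hr.trans hSt)

end

/-- The **Graham–Leeb–Rothschild theorem** over a finite field. -/
theorem exists_subspaceRamsey (F : Type) [Field F] [Finite F] {K : Type} [Finite K] [Nonempty K]
    (t : ℕ) (d : K → ℕ) : ∃ n : ℕ, SubspaceRamsey F t d (Fin n → F) := by
  classical
  have := Fintype.ofFinite K
  induction t generalizing d with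
  | zero =>
    refine ⟨∑ i, d i, fun c => ?_⟩
    obtain ⟨f, hf⟩ := finrank_le_iff_exists_linearMap (R := F) (M := Fin (d (c ⊥)) → F)
      (M' := Fin (∑ i, d i) → F) |>.mp
        (by simpa using Finset.single_le_sum (fun i _ => Nat.zero_le (d i)) (Finset.mem_univ _))
    refine ⟨c ⊥, LinearMap.range f, by simp [LinearMap.finrank_range_of_inj hf], fun S _ hS => ?_⟩
    rw [Submodule.finrank_eq_zero.mp hS]
  | succ t ih =>
    induction hs : ∑ i, d i generalizing d with
    | zero =>
      obtain ⟨i⟩ := ‹Nonempty K›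
      refine ⟨0, fun c => ⟨i, ⊥, ?_, fun S hS hSt => ?_⟩⟩
      · simp_all
      · rw [le_bot_iff.mp hS, finrank_bot] at hSt
        omega
    | succ s ihs =>
      by_cases hd : ∃ i, d i = 0
      · obtain ⟨i, hi⟩ := hd
        refine ⟨0, fun c => ⟨i, ⊥, by simp [hi], fun S hS hSt => ?_⟩⟩
        rw [le_bot_iff.mp hS, finrank_bot] at hSt
        omega
      push Not at hd
      have hupd : ∀ j, ∑ i, Function.update d j (d j - 1) i = s := by
        intro j
        have h1 := Finset.add_sum_erase Finset.univ d (Finset.mem_univ j)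
        rw [Finset.sum_update_of_mem (Finset.mem_univ j), Finset.sdiff_singleton_eq_erase]
        have := hd j
        omega
      choose m hm using fun j => ihs (Function.update d j (d j - 1)) (hupd j)
      -- The colour `j` is not known in advance, so `Z` must have room for every `m j`.
      obtain ⟨n, hn⟩ := ih fun _ => ∑ j, m j
      obtain ⟨ι, _, h⟩ := exists_graph_colour_eq (F := F) (Fin n → F) K
      have hV : SubspaceRamsey F (t + 1) d ((Fin n → F) × (ι → F)) := by
        intro c
        obtain ⟨a, w, hw, hc⟩ := h c
        obtain ⟨j, Z, hZ, hcZ⟩ := hn fun S =>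
          c (S.map (LinearMap.id.prod a) ⊔ F ∙ ((0, w) : (Fin n → F) × (ι → F)))
        obtain ⟨f, hf⟩ := finrank_le_iff_exists_linearMap (R := F) (M := Fin (m j) → F)
          (M' := Z) |>.mp (by
            simpa [hZ] using Finset.single_le_sum (fun i _ => Nat.zero_le (m i)) (Finset.mem_univ j))
        exact exists_monochromatic_of_graph hw hc (Nat.pos_of_ne_zero (hd j)) hcZ
          ((hm j).of_injective hf)
      exact ⟨_, hV.of_injective (Module.finBasis F _).equivFun.injective⟩

/-! ### Subspaces of the radical and the form -/

theorem mem_formRad_top_iff {V : Type*} [AddCommGroup V] [Module (ZMod 2) V]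
    {β : LinearMap.BilinForm (ZMod 2) V} {x : V} : x ∈ formRad β ⊤ ↔ ∀ y, β y x = 0 := by
  simp [formRad, LinearMap.BilinForm.mem_orthogonal_iff]

theorem finrank_sup_of_disjoint {F V : Type*} [Field F] [AddCommGroup V] [Module F V]
    {P Q : Submodule F V} [FiniteDimensional F P] [FiniteDimensional F Q] (h : Disjoint P Q) :
    Module.finrank F ↥(P ⊔ Q) = Module.finrank F P + Module.finrank F Q := by
  rw [← Submodule.finrank_sup_add_finrank_inf_eq, h.eq_bot, finrank_bot, add_zero]

theorem IsometricSubspaces.finrank_eq {V : Type*} [AddCommGroup V] [Module (ZMod 2) V]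
    {β : LinearMap.BilinForm (ZMod 2) V} {X Y : Submodule (ZMod 2) V}
    (h : IsometricSubspaces β X Y) : Module.finrank (ZMod 2) X = Module.finrank (ZMod 2) Y :=
  h.choose.finrank_eq

/-- The isomorphism of `P × Q` with the sum of the disjoint subspaces `P` and `Q`. -/
noncomputable def prodEquivSupOfDisjoint {F V : Type*} [Field F] [AddCommGroup V] [Module F V]
    {P Q : Submodule F V} (h : Disjoint P Q) : (P × Q) ≃ₗ[F] ↥(P ⊔ Q) :=
  (LinearEquiv.ofInjective (P.subtype.coprod Q.subtype) (by
    rw [← LinearMap.ker_eq_bot, LinearMap.ker_coprod_of_disjoint_range _ _ (by simpa using h)]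
    simp)).trans (LinearEquiv.ofEq _ _ (Submodule.sup_eq_range P Q).symm)

theorem coe_prodEquivSupOfDisjoint {F V : Type*} [Field F] [AddCommGroup V] [Module F V]
    {P Q : Submodule F V} (h : Disjoint P Q) (x : P × Q) :
    (prodEquivSupOfDisjoint h x : V) = x.1 + x.2 := by
  simp [prodEquivSupOfDisjoint]

/-- Replacing a summand in the radical by one of the same dimension gives an isometric subspace. -/
theorem isometricSubspaces_sup {V : Type*} [AddCommGroup V] [Module (ZMod 2) V]
    {β : LinearMap.BilinForm (ZMod 2) V} (hskew : ∀ u v : V, β u v = -β v u)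
    {P Q A₁ : Submodule (ZMod 2) V} [FiniteDimensional (ZMod 2) P] [FiniteDimensional (ZMod 2) Q]
    (hP : P ≤ formRad β ⊤) (hQ : Q ≤ formRad β ⊤) (hA₁ : Disjoint (formRad β ⊤) A₁)
    (h : Module.finrank (ZMod 2) P = Module.finrank (ZMod 2) Q) :
    IsometricSubspaces β (P ⊔ A₁) (Q ⊔ A₁) := by
  have hrad : ∀ x ∈ formRad β ⊤, ∀ y, β y x = 0 ∧ β x y = 0 := fun x hx y => by
    have := mem_formRad_top_iff.mp hx y
    exact ⟨this, by rw [hskew, this, neg_zero]⟩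
  let e := LinearEquiv.ofFinrankEq P Q h
  let p := prodEquivSupOfDisjoint (hA₁.mono_left hP)
  let q := prodEquivSupOfDisjoint (hA₁.mono_left hQ)
  refine ⟨p.symm.trans ((e.prodCongr (LinearEquiv.refl _ A₁)).trans q), fun x y => ?_⟩
  obtain ⟨⟨x, a⟩, rfl⟩ := p.surjective x
  obtain ⟨⟨y, a'⟩, rfl⟩ := p.surjective y
  simp [p, q, coe_prodEquivSupOfDisjoint, hrad _ (hP x.2), hrad _ (hP y.2), hrad _ (hQ (e x).2),
    hrad _ (hQ (e y).2)]

theorem IsHyperbolicRadicalBasis.exists_injective_range_le_formRad {V : Type*} [AddCommGroup V]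
    [Module (ZMod 2) V] {k : ℕ} {β : LinearMap.BilinForm (ZMod 2) V}
    {b : Module.Basis (ℕ ⊕ Fin k) (ZMod 2) V} (hb : IsHyperbolicRadicalBasis β b) (n : ℕ) :
    ∃ f : (Fin n → ZMod 2) →ₗ[ZMod 2] V, Function.Injective f ∧
      LinearMap.range f ≤ formRad β ⊤ := by
  have hmem : ∀ i, k ≤ i → b (Sum.inl i) ∈ formRad β ⊤ := by
    intro i hi
    rw [mem_formRad_top_iff]
    intro y
    have h0 : β.flip (b (Sum.inl i)) = 0 := by
      refine b.ext fun j => ?_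
      change β (b j) (b (Sum.inl i)) = 0
      rcases j with j | j
      · exact hb.e_e _ _
      · rw [hb.skew, hb.e_estar, if_neg (by omega), neg_zero]
    exact LinearMap.congr_fun h0 y
  have hli : LinearIndependent (ZMod 2) fun i : Fin n => b (Sum.inl (k + i)) :=
    b.linearIndependent.comp (fun i : Fin n => Sum.inl (k + (i : ℕ))) fun i j hij => by
      simpa [Fin.ext_iff] using hij
  refine ⟨Fintype.linearCombination (ZMod 2) fun i : Fin n => b (Sum.inl (k + i)),
    hli.fintypeLinearCombination_injective, ?_⟩
  rw [Fintype.range_linearCombination, Submodule.span_le]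
  rintro _ ⟨i, rfl⟩
  exact hmem _ (Nat.le_add_right _ _)

theorem mainTheorem3 {V : Type*} [AddCommGroup V] [Module (ZMod 2) V] (k : ℕ)
    (β : LinearMap.BilinForm (ZMod 2) V) (b : Module.Basis (ℕ ⊕ Fin k) (ZMod 2) V)
    (hb : IsHyperbolicRadicalBasis β b)
    (A A₀ A₁ : Submodule (ZMod 2) V) (hAfin : Finite A)
    (hdisj : Disjoint A₀ A₁) (hsum : A₀ ⊔ A₁ = A)
    (hA₁ : A₁ ≤ hyperbolicPart b)
    (hA₀ : A₀ = formRad β A) (hA₀' : A₀ = A ⊓ formRad β ⊤)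
    (r : ℕ) (B : Submodule (ZMod 2) V) (hBfin : Finite B)
    (hB : B ≤ formRad β ⊤ ⊔ A₁) (hAB : A ≤ B) :
    ∃ C : Submodule (ZMod 2) V, Finite C ∧ C ≤ formRad β ⊤ ⊔ A₁ ∧
      ∀ ξ : copiesIn β C A → Fin r,
        ∃ B' ∈ copiesIn β C B, A₁ ≤ B' ∧
          ∃ c : Fin r, ∀ A' : copiesIn β C A, (A' : Submodule (ZMod 2) V) ∈ copiesIn β B' A →
            (∃ A₀' : Submodule (ZMod 2) V,
              Disjoint A₀' A₁ ∧ A₀' ⊔ A₁ = (A' : Submodule (ZMod 2) V)) →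
            ξ A' = c := by
  classical
  -- With no colours there is no colouring, since `A` is itself a copy in `B`.
  obtain rfl | hr := r.eq_zero_or_pos
  · exact ⟨B, hBfin, hB, fun ξ => (ξ ⟨A, hAB, LinearEquiv.refl _ _, fun _ _ => rfl⟩).elim0⟩
  have : Nonempty (Fin r) := ⟨⟨0, hr⟩⟩
  have hA₁A : A₁ ≤ A := hsum ▸ le_sup_right
  have hRA₁ : Disjoint (formRad β ⊤) A₁ := by
    refine disjoint_iff_inf_le.mpr (le_trans (le_inf ?_ inf_le_right) hdisj.le_bot)
    rw [hA₀']
    exact le_inf (inf_le_right.trans hA₁A) inf_le_left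
  have hfd : ∀ {X : Submodule (ZMod 2) V}, X ≤ B → FiniteDimensional (ZMod 2) X := fun hX =>
    have := Module.Finite.of_finite (R := ZMod 2) (M := B)
    Submodule.finiteDimensional_of_le hX
  have := hfd (hA₁A.trans hAB)
  have : FiniteDimensional (ZMod 2) A₀ := hfd ((hsum ▸ le_sup_left : A₀ ≤ A).trans hAB)
  have : FiniteDimensional (ZMod 2) ↥(B ⊓ formRad β ⊤) := hfd inf_le_left
  have hsplit : ∀ X, A₁ ≤ X → X ≤ formRad β ⊤ ⊔ A₁ → X ⊓ formRad β ⊤ ⊔ A₁ = X := fun X h1 h2 => by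
    rw [inf_sup_assoc_of_le _ h1, inf_eq_left.mpr h2]
  obtain ⟨n, hn⟩ := exists_subspaceRamsey (ZMod 2) (Module.finrank (ZMod 2) A₀)
    fun _ : Fin r => Module.finrank (ZMod 2) ↥(B ⊓ formRad β ⊤)
  obtain ⟨f, hf, hfR⟩ := hb.exists_injective_range_le_formRad n
  have hmapR : ∀ T : Submodule (ZMod 2) (Fin n → ZMod 2), T.map f ≤ formRad β ⊤ := fun T => LinearMap.map_le_range.trans hfR
  refine ⟨LinearMap.range f ⊔ A₁, Module.finite_of_finite (ZMod 2), sup_le_sup_right hfR _,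
    fun ξ => ?_⟩
  obtain ⟨i, Y, hY, hc⟩ := hn fun T =>
    -- The default colour is harmless: only those `T` that give copies of `A` are examined below.
    if h : T.map f ⊔ A₁ ∈ copiesIn β (LinearMap.range f ⊔ A₁) A then ξ ⟨_, h⟩ else ⟨0, hr⟩
  refine ⟨Y.map f ⊔ A₁, ⟨sup_le_sup_right LinearMap.map_le_range _, ?_⟩, le_sup_right, i, ?_⟩
  · nth_rw 1 [← hsplit B (hA₁A.trans hAB) hB]
    exact isometricSubspaces_sup hb.skew inf_le_right (hmapR Y) hRA₁
      (hY.symm.trans (Submodule.equivMapOfInjective f hf Y).finrank_eq)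
  · rintro ⟨A', hA'C, hA'⟩ ⟨hA'B, -⟩ ⟨A₀', -, hA₀'⟩
    have hA₁A' : A₁ ≤ A' := le_sup_right.trans hA₀'.le
    have hA'split := hsplit A' hA₁A' (hA'C.trans (sup_le_sup_right hfR _))
    -- By modularity, `(f(Y) ⊕ A₁) ∩ Rad(V) = f(Y)`.
    have hle : A' ⊓ formRad β ⊤ ≤ Y.map f := by
      refine (inf_le_inf_right _ hA'B).trans ?_
      rw [sup_inf_assoc_of_le _ (hmapR Y), inf_comm, hRA₁.eq_bot, sup_bot_eq]
    obtain ⟨T, hT, hTA', hTr⟩ := Submodule.exists_map_eq_of_le_map hf hle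
    have : FiniteDimensional (ZMod 2) ↥(A' ⊓ formRad β ⊤) :=
      Submodule.finiteDimensional_of_le hle
    have hrank := hA'.finrank_eq
    rw [← hA'split, finrank_sup_of_disjoint (hRA₁.mono_left inf_le_right), ← hsum,
      finrank_sup_of_disjoint hdisj] at hrank
    have hcT := hc T hT (by omega)
    have hTeq : T.map f ⊔ A₁ = A' := by rw [hTA', hA'split]
    subst hTeq
    rwa [dif_pos ⟨hA'C, hA'⟩] at hcT
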